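/- Let $r\ge 1$ and $n\ge 0$ be integers. Write $[k]_q=1+q+\cdots+q^{k-1}$ (with $[0]_q=0$) and $[k]_q!=[1]_q[2]_q\cdots[k]_q$. Define the $r$-colored $q$-Stirling numbers of the second kind by $$S_r[n,k]=S_r[n-1,k-1]+[rk+1]_q\,S_r[n-1,k]\quad(n\ge 1),\qquad S_r[0,k]=\delta_{0k},$$ with $S_r[n,k]=0$ for $k<0$. A colored permutation $\pi=\pi_1^{z_1}\cdots\pi_n^{z_n}\in\mathbb Z_r\wr\mathfrak S_n$ consists of a permutation $\pi_1\cdots\pi_n$ of $\{1,\dots,n\}$ and colors $z_i\in\{0,\dots,r-1\}$. Order the colored letters by $$n^{r-1}<\cdots<n^1<\cdots<1^{r-1}<\cdots<1^1<0<1<\cdots<n,$$ where $k$ means $k^0$, and set $\pi_0^{z_0}=0$. Let $\mathrm{Des}_r(\pi)$ be the set of $i\in\{0,1,\dots,n-1\}$ with $\pi_i^{z_i}>\pi_{i+1}^{z_{i+1}}$, let $\mathrm{des}_r(\pi)=|\mathrm{Des}_r(\pi)|$ and $\mathrm{fmaj}_r(\pi)=r\sum_{i\in\mathrm{Des}_r(\pi)}i+\sum_{i=1}^n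 z_i$, and put $$A_n^r(t,q)=\sum_{\pi\in\mathbb Z_r\wr\mathfrak S_n}t^{\mathrm{des}_r(\pi)}q^{\mathrm{fmaj}_r(\pi)}.$$ Then $$\frac{A_n^r(t,q)}{\prod_{i=0}^n(1-tq^{ri})}=\sum_{k=0}^n\frac{q^{r\binom{k+1}{2}+(1-r)k}\,[r]_q^k\,[k]_{q^r}!\,S_r[n,k]\,t^k}{\prod_{i=0}^k(1-tq^{ri})}.$$ This holds for all elements $t,q$ of any field $K$ such that $1-tq^{ri}\ne 0$ for $0\le i\le n$; in particular it holds as an identity of rational functions in two indeterminates $t,q$. -/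

import Mathlib

namespace ColoredEulerian

/-- The `q`-integer `[k]_q = 1 + q + ⋯ + q ^ (k - 1)`, with `[0]_q = 0`. -/
def qInt {R : Type*} [CommRing R] (q : R) (k : ℕ) : R :=
  ∑ i ∈ Finset.range k, q ^ i

/-- The `q`-factorial `[k]_q! = [1]_q [2]_q ⋯ [k]_q`. -/
def qFactorial {R : Type*} [CommRing R] (q : R) (k : ℕ) : R :=
  ∏ i ∈ Finset.range k, qInt q (i + 1)

/-- The `r`-colored `q`-Stirling numbers of the second kind:
`S_r[n, k] = S_r[n - 1, k - 1] + [r k + 1]_q S_r[n - 1, k]` with `S_r[0, k] = δ_{0 k}`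
(and `S_r[n, k] = 0` for negative `k`). The last two arguments are `n` and `k`. -/
def qStirling {R : Type*} [CommRing R] (r : ℕ) (q : R) : ℕ → ℕ → R
  | 0, 0 => 1
  | 0, _ + 1 => 0
  | n + 1, 0 => qInt q (r * 0 + 1) * qStirling r q n 0
  | n + 1, k + 1 => qStirling r q n k + qInt q (r * (k + 1) + 1) * qStirling r q n (k + 1)

/-- Colored permutations `π₁^{z₁} ⋯ πₙ^{zₙ}`, the elements of the wreath product of `ℤ_r` with the
symmetric group: a permutation together with a color in `{0, …, r - 1}` for every position. -/
abbrev ColoredPerm (r n : ℕ) : Type := Equiv.Perm (Fin n) × (Fin n → Fin r)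

/-- The order on colored letters. The pair `(a, z)` stands for the letter `a^z`, and `(0, 0)` is
the letter `0`. It is the order
`n^{r-1} < ⋯ < n^1 < ⋯ < 1^{r-1} < ⋯ < 1^1 < 0 < 1 < ⋯ < n` (where `k` is `k^0`). -/
def LetterLT (x y : ℕ × ℕ) : Prop :=
  (x.2 = 0 ∧ y.2 = 0 ∧ x.1 < y.1) ∨
  (x.2 ≠ 0 ∧ y.2 = 0) ∨
  (x.2 ≠ 0 ∧ y.2 ≠ 0 ∧ (y.1 < x.1 ∨ (x.1 = y.1 ∧ y.2 < x.2)))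

instance : DecidableRel LetterLT := fun x y => by
  unfold LetterLT; infer_instance

/-- The letter at position `i` (positions are `1, …, n`, letters are `1, …, n`), with the
convention that the letter at position `0` is `0`; beyond `n` the value is irrelevant. -/
def letter {r n : ℕ} (π : ColoredPerm r n) (i : ℕ) : ℕ × ℕ :=
  if h : 1 ≤ i ∧ i ≤ n then
    ((π.1 ⟨i - 1, by omega⟩ : ℕ) + 1, (π.2 ⟨i - 1, by omega⟩ : ℕ))
  else (0, 0)

/-- The descent set: all `i ∈ {0, …, n - 1}` whose letter is larger than the next one. -/
def descents {r n : ℕ} (π : ColoredPerm r n) : Finset ℕ :=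
  {i ∈ Finset.range n | LetterLT (letter π (i + 1)) (letter π i)}

/-- The number of descents. -/
def des {r n : ℕ} (π : ColoredPerm r n) : ℕ := (descents π).card

/-- The flag-major index: `r` times the sum of the descents plus the sum of the colors. -/
def fmaj {r n : ℕ} (π : ColoredPerm r n) : ℕ :=
  r * ∑ i ∈ descents π, i + ∑ j : Fin n, (π.2 j : ℕ)

/-- The `q`-analogue `A_n^r(t, q)` of the `r`-colored Eulerian polynomial. -/
def qEulerian {R : Type*} [CommRing R] (r n : ℕ) (t q : R) : R :=
  ∑ π : ColoredPerm r n, t ^ des π * q ^ fmaj π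

end ColoredEulerian

/-! Put `x i = t * q ^ (r * i)`; a colored permutation then weighs `q` to its color sum times the
product of `x i` over its descents. Write each position's factor as `x i` plus `1 - x i` times the
indicator of an ascent, and split by the last position where `x i` is taken. The letters after it
increase, so their set determines them. This expresses the sum over arrangements of `E` through
proper subsets `F` (`descentSum_eq`, `coloredSum_eq`).

After division by the denominator this becomes S_n = 1 + t ∑_j C(n,j) [r]^(n-j) q^(rj) S_j, the
recursion of S_n = ∑_m t^m [rm+1]^n, because [r(m+1)+1] = [r] + q^r [rm+1]. The Stirling numbers
expand x^n in the Newton basis with nodes [ri+1], and summing that basis over the nodes yields the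
right-hand side. Since `K` is an arbitrary field, no infinite series is used: the closed form is
shown to satisfy the same recursion (`stirlingSeries_rec`). -/

namespace ColoredEulerian

open Finset

/-! ### Words of distinct letters -/

section LetterValue

variable {ι Λ : Type*}

/-- The value of the `i`-th letter of an arrangement, preceded by the base value `o`. -/
def letterValue (κ : ι → Λ) (o : Λ) {m : ℕ} (g : Fin m → ι) (i : ℕ) : Λ :=
  if h : 1 ≤ i ∧ i ≤ m then κ (g ⟨i - 1, by omega⟩) else o

lemma letterValue_snoc_of_le (κ : ι → Λ) (o : Λ) {m : ℕ} (g : Fin m → ι) (a : ι) {i : ℕ}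
    (hi : i ≤ m) :
    letterValue κ o (Fin.snoc g a : Fin (m + 1) → ι) i = letterValue κ o g i := by
  unfold letterValue
  by_cases h : 1 ≤ i
  · rw [dif_pos ⟨h, by omega⟩, dif_pos ⟨h, hi⟩]
    congr 1
    exact Fin.snoc_castSucc (α := fun _ => ι) a g ⟨i - 1, by omega⟩
  · rw [dif_neg (by omega), dif_neg (by omega)]

lemma letterValue_snoc_last (κ : ι → Λ) (o : Λ) {m : ℕ} (g : Fin m → ι) (a : ι) :
    letterValue κ o (Fin.snoc g a : Fin (m + 1) → ι) (m + 1) = κ a := by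
  unfold letterValue
  rw [dif_pos ⟨by omega, le_rfl⟩]
  congr 1
  exact Fin.snoc_last (α := fun _ => ι) a g

/-- The arrangements of length `m` of letters from `E` without repetition. -/
def arrangements [Fintype ι] [DecidableEq ι] (m : ℕ) (E : Finset ι) : Finset (Fin m → ι) :=
  {g | Function.Injective g ∧ ∀ i, g i ∈ E}

lemma letterValue_ne [Fintype ι] [DecidableEq ι] {κ : ι → Λ} {o : Λ}
    (hκ : Function.Injective κ) (ho : ∀ a, κ a ≠ o) {m : ℕ} {E : Finset ι} {a : ι} {g : Fin m → ι} (hg : g ∈ arrangements m (E.erase a)) :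
    letterValue κ o g m ≠ κ a := by
  unfold letterValue
  split_ifs with h
  · intro e
    have := (mem_filter.1 hg).2.2 ⟨m - 1, by omega⟩
    rw [hκ e] at this
    simp at this
  · exact (ho a).symm

end LetterValue

/-! ### Descent sums: splitting at the last chosen position -/

section Arrangements

variable {ι Λ R : Type*} [Fintype ι] [DecidableEq ι] [LinearOrder Λ] [CommRing R]

/-- The product of `x i` over the descents `i` of an arrangement. -/
def descentWeight (κ : ι → Λ) (o : Λ) (x : ℕ → R) {m : ℕ} (g : Fin m → ι) : R :=
  ∏ i ∈ range m, if letterValue κ o g (i + 1) < letterValue κ o g i then x i else 1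

/-- The descent weights of the arrangements of `E`, summed. -/
def descentSum (κ : ι → Λ) (o : Λ) (x : ℕ → R) (m : ℕ) (E : Finset ι) : R :=
  ∑ g ∈ arrangements m E, descentWeight κ o x g

/-- The descent weights of the arrangements of `E` whose last letter is below `y`, summed. -/
def descentSumBelow (κ : ι → Λ) (o : Λ) (x : ℕ → R) (m : ℕ) (E : Finset ι) (y : Λ) : R :=
  ∑ g ∈ arrangements m E, if letterValue κ o g m < y then descentWeight κ o x g else 0

lemma snoc_mem_arrangements {m : ℕ} {E : Finset ι} {g : Fin m → ι} {a : ι} :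
    (Fin.snoc g a : Fin (m + 1) → ι) ∈ arrangements (m + 1) E ↔
      a ∈ E ∧ g ∈ arrangements m (E.erase a) := by
  simp only [arrangements, mem_filter, mem_univ, true_and, Fin.snoc_injective_iff, mem_erase,
    Fin.forall_fin_succ', Fin.snoc_castSucc, Fin.snoc_last, Set.mem_range, not_exists]
  constructor
  · rintro ⟨⟨h1, h2⟩, h3, h4⟩
    exact ⟨h4, h1, fun i => ⟨h2 i, h3 i⟩⟩
  · rintro ⟨h4, h1, h⟩
    exact ⟨⟨h1, fun i => (h i).1⟩, fun i => (h i).2, h4⟩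

lemma sum_arrangements_succ (m : ℕ) (E : Finset ι) (f : (Fin (m + 1) → ι) → R) :
    ∑ g ∈ arrangements (m + 1) E, f g =
      ∑ a ∈ E, ∑ g ∈ arrangements m (E.erase a), f (Fin.snoc g a) := by
  rw [sum_sigma']
  symm
  refine sum_bij' (fun p _ => Fin.snoc p.2 p.1) (fun g _ => ⟨g (Fin.last m), Fin.init g⟩)
    ?_ ?_ ?_ ?_ ?_
  · rintro ⟨a, g⟩ h
    exact snoc_mem_arrangements.2 (mem_sigma.1 h)
  · intro g h
    rw [← Fin.snoc_init_self g] at h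
    exact mem_sigma.2 (snoc_mem_arrangements.1 h)
  · rintro ⟨a, g⟩ h
    simp
  · intro g h
    simp
  · rintro ⟨a, g⟩ h
    rfl

omit [Fintype ι] [DecidableEq ι] in
lemma descentWeight_snoc (κ : ι → Λ) (o : Λ) (x : ℕ → R) {m : ℕ} (g : Fin m → ι) (a : ι) :
    descentWeight κ o x (Fin.snoc g a : Fin (m + 1) → ι) =
      descentWeight κ o x g * if κ a < letterValue κ o g m then x m else 1 := by
  unfold descentWeight
  rw [prod_range_succ, letterValue_snoc_last, letterValue_snoc_of_le κ o g a le_rfl]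
  congr 1
  refine prod_congr rfl fun i hi => ?_
  have := mem_range.1 hi
  rw [letterValue_snoc_of_le κ o g a (by omega), letterValue_snoc_of_le κ o g a (by omega)]

variable {κ : ι → Λ} {o : Λ}

/-- Remove the last letter `a`. Position `m` contributes `x m + (1 - x m) * [ascent]`, and an ascent
means that the previous letter is below `κ a`. -/
lemma descentSumBelow_succ (hκ : Function.Injective κ) (ho : ∀ a, κ a ≠ o) (x : ℕ → R) (m : ℕ)
    (E : Finset ι) (y : Λ) :
    descentSumBelow κ o x (m + 1) E y =
      ∑ a ∈ E, if κ a < y then x m * descentSum κ o x m (E.erase a) +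
        (1 - x m) * descentSumBelow κ o x m (E.erase a) (κ a) else 0 := by
  unfold descentSumBelow descentSum
  rw [sum_arrangements_succ]
  refine sum_congr rfl fun a _ => ?_
  simp only [letterValue_snoc_last, descentWeight_snoc]
  split_ifs with hy
  · rw [mul_sum, mul_sum, ← sum_add_distrib]
    refine sum_congr rfl fun g hg => ?_
    rcases lt_or_gt_of_ne (letterValue_ne hκ ho hg) with h | h
    · rw [if_pos h, if_neg h.not_gt]; ring
    · rw [if_neg h.not_gt, if_pos h]; ring
  · simp

/-- An increasing tail with letter set `U` must end in the unique maximum of `U`, so summing over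
the last letter counts it once. -/
lemma sum_ite_isMax (hκ : Function.Injective κ) {U : Finset ι} (hU : U.Nonempty) (y : Λ) (v : R) :
    (∑ a ∈ U, if κ a < y ∧ ∀ b ∈ U, b ≠ a → κ b < κ a then v else 0) =
      if ∀ b ∈ U, κ b < y then v else 0 := by
  obtain ⟨c, hc, hmax⟩ := exists_max_image U κ hU
  have hlt : ∀ b ∈ U, b ≠ c → κ b < κ c := fun b hb hbc =>
    lt_of_le_of_ne (hmax b hb) (hκ.ne hbc)
  rw [sum_eq_single_of_mem c hc]
  · refine if_congr ⟨fun h b hb => (hmax b hb).trans_lt h.1, fun h => ⟨h c hc, hlt⟩⟩ rfl rfl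
  · intro a ha hac
    exact if_neg fun h => (hlt a ha hac).asymm (h.2 c hc hac.symm)

/-- `F` is the set of letters up to the last position where `x i` is taken, and `E \ F` is the
increasing tail. The first summand is the case with no such position. The bound `y` makes the
induction on the last letter close. -/
lemma descentSumBelow_eq (hκ : Function.Injective κ) (ho : ∀ a, κ a ≠ o) (x : ℕ → R) (m : ℕ) :
    ∀ (E : Finset ι) (y : Λ), #E = m → descentSumBelow κ o x m E y =
      (if o < y ∧ (∀ a ∈ E, o < κ a) ∧ ∀ a ∈ E, κ a < y then ∏ i ∈ range m, (1 - x i) else 0) +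
      ∑ F ∈ E.ssubsets, if ∀ a ∈ E \ F, κ a < y then
        x #F * descentSum κ o x #F F * ∏ i ∈ Ioo #F m, (1 - x i) else 0 := by
  induction m with
  | zero =>
    intro E y hE
    obtain rfl := card_eq_zero.1 hE
    have : arrangements 0 (∅ : Finset ι) = {default} := by
      ext g
      obtain rfl := Subsingleton.elim g default
      simp [arrangements, Function.injective_of_subsingleton]
    have h0 : (∅ : Finset ι).ssubsets = ∅ := rfl
    simp [descentSumBelow, this, h0, letterValue, descentWeight]
  | succ m ih =>
    intro E y hE
    have hne : E.Nonempty := card_pos.1 (by omega)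
    rw [descentSumBelow_succ hκ ho]
    set G : Finset ι → R := fun F =>
      x #F * descentSum κ o x #F F * ∏ i ∈ Ioo #F (m + 1), (1 - x i) with hG
    set P : R := ∏ i ∈ range (m + 1), (1 - x i) with hP
    -- With last letter `a`, only those `F` occur for which `a` is the maximum of the tail `E \ F`.
    have key : ∀ a ∈ E, (if κ a < y then x m * descentSum κ o x m (E.erase a) +
        (1 - x m) * descentSumBelow κ o x m (E.erase a) (κ a) else 0) =
        (if κ a < y ∧ ∀ b ∈ E, b ≠ a → κ b < κ a then
          (if ∀ b ∈ E, o < κ b then P else 0) else 0) +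
        ∑ F ∈ E.ssubsets, if a ∈ E \ F then
          (if κ a < y ∧ ∀ b ∈ E \ F, b ≠ a → κ b < κ a then G F else 0) else 0 := by
      intro a ha
      have hcard : #(E.erase a) = m := by rw [card_erase_of_mem ha]; omega
      by_cases hy : κ a < y
      · rw [if_pos hy, ih _ _ hcard, mul_add, add_left_comm]
        congr 1
        · rw [mul_ite, mul_zero, hP, prod_range_succ, mul_comm, ← ite_and]
          refine if_congr ⟨?_, ?_⟩ rfl rfl
          · rintro ⟨h1, h2, h3⟩
            refine ⟨⟨hy, fun b hb hba => h3 b (mem_erase.2 ⟨hba, hb⟩)⟩, fun b hb => ?_⟩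
            by_cases hba : b = a
            · exact hba ▸ h1
            · exact h2 b (mem_erase.2 ⟨hba, hb⟩)
          · rintro ⟨⟨-, h1⟩, h2⟩
            exact ⟨h2 a ha, fun b hb => h2 b (mem_of_mem_erase hb),
              fun b hb => h1 b (mem_of_mem_erase hb) (ne_of_mem_erase hb)⟩
        · have hsub : ∑ F ∈ E.ssubsets, (if a ∈ E \ F then
              (if κ a < y ∧ ∀ b ∈ E \ F, b ≠ a → κ b < κ a then G F else 0) else 0) =
              ∑ F ∈ (E.erase a).powerset,
                if ∀ b ∈ (E.erase a) \ F, κ b < κ a then G F else 0 := by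
            rw [← sum_filter]
            refine sum_congr ?_ fun F hF => ?_
            · ext F
              simp only [mem_filter, mem_ssubsets, mem_sdiff, mem_powerset, subset_erase]
              constructor
              · rintro ⟨h1, h2⟩
                exact ⟨h1.subset, h2.2⟩
              · rintro ⟨h1, h2⟩
                exact ⟨⟨h1, fun h => h2 (h ha)⟩, ha, h2⟩
            · refine if_congr ⟨?_, ?_⟩ rfl rfl
              · rintro ⟨-, h⟩ b hb
                simp only [mem_sdiff, mem_erase] at hb
                exact h b (mem_sdiff.2 ⟨hb.1.2, hb.2⟩) hb.1.1
              · intro h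
                refine ⟨hy, fun b hb hba => h b ?_⟩
                simp only [mem_sdiff, mem_erase] at hb ⊢
                exact ⟨⟨hba, hb.1⟩, hb.2⟩
          -- `F = E.erase a` is the tail `{a}`, where `x m` itself is taken; smaller `F` come from
          -- the induction hypothesis times `1 - x m`.
          rw [hsub, ← insert_erase (mem_powerset_self (E.erase a)), sum_insert (notMem_erase _ _)]
          congr 1
          · have : Ioo m (m + 1) = ∅ := by ext i; simp
            simp [hG, hcard, this]
          · rw [mul_sum]
            refine sum_congr rfl fun F hF => ?_
            rw [mul_ite, mul_zero]
            refine if_congr Iff.rfl ?_ rfl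
            have hlt : #F < m := hcard ▸ card_lt_card (mem_ssubsets.1 hF)
            have : Ioo #F (m + 1) = insert m (Ioo #F m) := by
              ext i
              simp only [mem_Ioo, mem_insert]
              omega
            rw [hG]
            simp only [this]
            rw [prod_insert (by simp)]
            ring
      · simp [hy]
    rw [sum_congr rfl key, sum_add_distrib, sum_ite_isMax hκ hne, sum_comm]
    congr 1
    · rw [← ite_and]
      obtain ⟨e, he⟩ := hne
      refine if_congr ⟨fun h => ⟨(h.2 e he).trans (h.1 e he), h.2, h.1⟩,
        fun h => ⟨h.2.2, h.2.1⟩⟩ rfl rfl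
    · refine sum_congr rfl fun F hF => ?_
      rw [← sum_filter, filter_mem_eq_inter, inter_eq_right.2 sdiff_subset]
      exact sum_ite_isMax hκ (sdiff_nonempty.2 (mem_ssubsets.1 hF).2) y (G F)

lemma descentSum_eq [OrderTop Λ] (hκ : Function.Injective κ) (ho : ∀ a, κ a ≠ o)
    (hκ_top : ∀ a, κ a < ⊤) (ho_top : o < ⊤) (x : ℕ → R) (E : Finset ι) :
    descentSum κ o x #E E = (if ∀ a ∈ E, o < κ a then ∏ i ∈ range #E, (1 - x i) else 0) +
      ∑ F ∈ E.ssubsets, x #F * descentSum κ o x #F F * ∏ i ∈ Ioo #F #E, (1 - x i) := by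
  have h := descentSumBelow_eq hκ ho x _ E ⊤ rfl
  have h2 : descentSumBelow κ o x #E E ⊤ = descentSum κ o x #E E := by
    refine sum_congr rfl fun g _ => if_pos ?_
    unfold letterValue
    split_ifs
    · exact hκ_top _
    · exact ho_top
  rw [h2] at h
  simpa [hκ_top, ho_top] using h

end Arrangements

end ColoredEulerian

namespace ColoredEulerian

open Finset

/-! ### Stirling numbers as Newton coefficients -/

section Stirling

variable {R : Type*} [CommRing R]

lemma qInt_add (q : R) (a b : ℕ) : qInt q (a + b) = qInt q a + q ^ a * qInt q b := by
  simp only [qInt, sum_range_add, mul_sum, pow_add]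

lemma qInt_succ' (q : R) (a : ℕ) : qInt q (a + 1) = 1 + q * qInt q a := by
  rw [add_comm, qInt_add]
  simp [qInt]

lemma qInt_mul (q : R) (r k : ℕ) : qInt q (r * k) = qInt q r * qInt (q ^ r) k := by
  induction k with
  | zero => simp [qInt]
  | succ k ih =>
    rw [mul_add_one, qInt_add, ih]
    simp only [qInt, sum_range_succ]
    ring

/-- Multiplication by the variable in the Newton basis with nodes `[r k + 1]_q`. -/
def newtonMul (r : ℕ) (q : R) : Module.End R (ℕ → R) where
  toFun s k := (if k = 0 then 0 else s (k - 1)) + qInt q (r * k + 1) * s k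
  map_add' s s' := by ext k; dsimp; split_ifs <;> ring
  map_smul' c s := by ext k; dsimp; split_ifs <;> ring

/-- The substitution `x ↦ [r]_q + q ^ r x` in the Newton basis with nodes `[r k + 1]_q`. -/
def newtonSubst (r : ℕ) (q : R) : Module.End R (ℕ → R) where
  toFun s k := q ^ (r * k) * (s k + (qInt q (r * (k + 1) + 1) - 1) * s (k + 1))
  map_add' s s' := by ext k; dsimp; ring
  map_smul' c s := by ext k; dsimp; ring

/-- The coefficient form of (x f)(σ x) = σ(x) f(σ x), where σ(x) = [r] + q^r x sends each node to
the next. -/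
lemma newtonSubst_mul_newtonMul (r : ℕ) (q : R) :
    newtonSubst r q * newtonMul r q =
      (algebraMap R _ (qInt q r) + q ^ r • newtonMul r q) * newtonSubst r q := by
  ext s k
  have step : ∀ k, qInt q (r * (k + 1) + 1) = qInt q r + q ^ r * qInt q (r * k + 1) := by
    intro k
    rw [← qInt_add]; congr 1; ring
  rcases k with _ | k
  · have h0 : qInt q 1 = 1 := by simp [qInt]
    simp only [newtonSubst, newtonMul, Module.End.mul_apply, LinearMap.add_apply,
      LinearMap.smul_apply, Module.algebraMap_end_apply, LinearMap.coe_mk, AddHom.coe_mk,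
      Pi.add_apply, Pi.smul_apply, smul_eq_mul, step, if_true,
      one_ne_zero, if_false, mul_zero, pow_zero, zero_add, h0]
    ring
  · simp only [newtonSubst, newtonMul, Module.End.mul_apply, LinearMap.add_apply,
      LinearMap.smul_apply, Module.algebraMap_end_apply, LinearMap.coe_mk, AddHom.coe_mk,
      Pi.add_apply, Pi.smul_apply, smul_eq_mul, step]
    simp only [Nat.add_eq_zero_iff, one_ne_zero, and_false, if_false, Nat.add_sub_cancel]
    ring

lemma newtonMul_qStirling (r : ℕ) (q : R) (n : ℕ) :
    newtonMul r q (qStirling r q n) = qStirling r q (n + 1) := by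
  ext k
  rcases k with _ | k <;> simp [newtonMul, qStirling]

lemma newtonMul_pow_qStirling (r : ℕ) (q : R) (n : ℕ) :
    (newtonMul r q ^ n) (qStirling r q 0) = qStirling r q n := by
  induction n with
  | zero => rfl
  | succ n ih => rw [pow_succ', Module.End.mul_apply, ih, newtonMul_qStirling]

lemma newtonSubst_qStirling_zero (r : ℕ) (q : R) :
    newtonSubst r q (qStirling r q 0) = qStirling r q 0 := by
  ext k
  rcases k with _ | k <;> simp [newtonSubst, qStirling]

/-- This is the binomial expansion of ([r] + q^r x)^n: `qStirling r q n` holds the Newton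
coefficients of x^n. -/
lemma newtonSubst_qStirling (r : ℕ) (q : R) (n : ℕ) :
    newtonSubst r q (qStirling r q n) = ∑ j ∈ range (n + 1),
      ((n.choose j : R) * qInt q r ^ (n - j) * q ^ (r * j)) • qStirling r q j := by
  have hpow : ∀ n, newtonSubst r q * newtonMul r q ^ n =
      (q ^ r • newtonMul r q + algebraMap R _ (qInt q r)) ^ n * newtonSubst r q := by
    intro n
    induction n with
    | zero => simp
    | succ n ih =>
      rw [pow_succ, ← mul_assoc, ih, mul_assoc, newtonSubst_mul_newtonMul, pow_succ, mul_assoc,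
        add_comm (q ^ r • newtonMul r q)]
  rw [← newtonMul_pow_qStirling, ← Module.End.mul_apply, hpow, Module.End.mul_apply,
    newtonSubst_qStirling_zero,
    Commute.add_pow (Algebra.commutes (qInt q r) (q ^ r • newtonMul r q)).symm, LinearMap.sum_apply]
  refine sum_congr rfl fun j _ => ?_
  rw [← newtonMul_pow_qStirling r q j, smul_pow, ← map_pow, ← pow_mul, ← map_natCast
    (algebraMap R (Module.End R (ℕ → R))), mul_assoc, ← map_mul, Module.End.mul_apply,
    Module.algebraMap_end_apply, LinearMap.map_smul, LinearMap.smul_apply, smul_smul]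
  congr 1
  ring

lemma qStirling_eq_zero_of_lt (r : ℕ) (q : R) (n : ℕ) : ∀ k, n < k → qStirling r q n k = 0 := by
  induction n with
  | zero => rintro (_ | k) h <;> simp [qStirling] at *
  | succ n ih =>
    rintro (_ | k) h
    · omega
    · rw [qStirling, ih k (by omega), ih (k + 1) (by omega)]; ring

lemma qStirling_zero_right (r : ℕ) (q : R) (n : ℕ) : qStirling r q n 0 = 1 := by
  induction n with
  | zero => rfl
  | succ n ih => simp [qStirling, ih, qInt]

end Stirling

/-! ### The recursion for the Stirling side -/

section Series

variable {K : Type*} [Field K]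

/-- The value at `t` of the generating function of the `k`-th Newton polynomial with nodes
`[r i + 1]_q`, evaluated at all nodes. -/
def newtonSeries (r : ℕ) (t q : K) (k : ℕ) : K :=
  q ^ (r * k.choose 2 + k) * qInt q r ^ k * qFactorial (q ^ r) k * t ^ k /
    ∏ i ∈ range (k + 1), (1 - t * q ^ (r * i))

/-- The sum of the `q`-Stirling numbers against the Newton series. -/
def stirlingSeries (r n : ℕ) (t q : K) : K :=
  ∑ k ∈ range (n + 1), qStirling r q n k * newtonSeries r t q k

lemma newtonSeries_zero (r : ℕ) {t q : K} (h : 1 - t ≠ 0) :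
    newtonSeries r t q 0 = 1 + t * newtonSeries r t q 0 := by
  simp [newtonSeries, qFactorial]
  field_simp
  ring

/-- Shifting the node index in ∑_m t^m N_{k+1}([rm+1]) replaces N_{k+1} by its substitution; the `m
= 0` term vanishes as [1] is a root. -/
lemma newtonSeries_succ (r : ℕ) {t q : K} (k : ℕ) (h : 1 - t * q ^ (r * (k + 1)) ≠ 0) :
    newtonSeries r t q (k + 1) = t * (q ^ (r * (k + 1)) * newtonSeries r t q (k + 1) +
      q ^ (r * k) * (qInt q (r * (k + 1) + 1) - 1) * newtonSeries r t q k) := by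
  have e : newtonSeries r t q (k + 1) * (1 - t * q ^ (r * (k + 1))) =
      t * (q ^ (r * k) * (qInt q (r * (k + 1) + 1) - 1) * newtonSeries r t q k) := by
    unfold newtonSeries
    rw [prod_range_succ _ (k + 1), ← div_div, div_mul_cancel₀ _ h, ← mul_div_assoc,
      ← mul_div_assoc]
    congr 1
    rw [qInt_succ', qInt_mul, qFactorial, prod_range_succ, ← qFactorial, Nat.choose_succ_succ',
      Nat.choose_one_right]
    ring
  linear_combination e

lemma stirlingSeries_eq_sum_range (r n m : ℕ) (t q : K) (h : n ≤ m) :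
    stirlingSeries r n t q = ∑ k ∈ range (m + 1), qStirling r q n k * newtonSeries r t q k := by
  refine sum_subset (range_mono (by omega)) fun k _ hk => ?_
  rw [qStirling_eq_zero_of_lt r q n k (by simpa using hk), zero_mul]

lemma stirlingSeries_rec (r n : ℕ) (t q : K)
    (hden : ∀ i ∈ range (n + 1), 1 - t * q ^ (r * i) ≠ 0) :
    stirlingSeries r n t q = 1 + t * ∑ j ∈ range (n + 1),
      (n.choose j : K) * qInt q r ^ (n - j) * q ^ (r * j) * stirlingSeries r j t q := by
  have h1 : ∑ j ∈ range (n + 1),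
      (n.choose j : K) * qInt q r ^ (n - j) * q ^ (r * j) * stirlingSeries r j t q =
      ∑ k ∈ range (n + 1), newtonSubst r q (qStirling r q n) k * newtonSeries r t q k := by
    rw [newtonSubst_qStirling]
    simp only [Finset.sum_apply, Pi.smul_apply, smul_eq_mul, sum_mul]
    rw [sum_comm]
    refine sum_congr rfl fun j hj => ?_
    rw [stirlingSeries_eq_sum_range r j n t q (by have := mem_range.1 hj; omega), mul_sum]
    exact sum_congr rfl fun k _ => by ring
  have h2 : ∑ k ∈ range (n + 1), newtonSubst r q (qStirling r q n) k * newtonSeries r t q k =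
      ∑ k ∈ range (n + 1), q ^ (r * k) * qStirling r q n k * newtonSeries r t q k +
      ∑ k ∈ range n, q ^ (r * k) * (qInt q (r * (k + 1) + 1) - 1) * qStirling r q n (k + 1) *
        newtonSeries r t q k := by
    have : ∑ k ∈ range n, q ^ (r * k) * (qInt q (r * (k + 1) + 1) - 1) * qStirling r q n (k + 1) *
        newtonSeries r t q k = ∑ k ∈ range (n + 1), q ^ (r * k) *
          (qInt q (r * (k + 1) + 1) - 1) * qStirling r q n (k + 1) * newtonSeries r t q k := by
      rw [sum_range_succ, qStirling_eq_zero_of_lt r q n (n + 1) (by omega)]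
      ring
    rw [this, ← sum_add_distrib]
    refine sum_congr rfl fun k _ => ?_
    simp only [newtonSubst, LinearMap.coe_mk, AddHom.coe_mk]
    ring
  have h0 : 1 - t ≠ 0 := by simpa using hden 0 (by simp)
  rw [h1, h2, stirlingSeries, sum_range_succ', sum_range_succ' (fun k =>
    q ^ (r * k) * qStirling r q n k * newtonSeries r t q k), qStirling_zero_right]
  have h3 : ∑ k ∈ range n, qStirling r q n (k + 1) * newtonSeries r t q (k + 1) =
      t * (∑ k ∈ range n, q ^ (r * (k + 1)) * qStirling r q n (k + 1) *
          newtonSeries r t q (k + 1) +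
        ∑ k ∈ range n, q ^ (r * k) * (qInt q (r * (k + 1) + 1) - 1) * qStirling r q n (k + 1) *
          newtonSeries r t q k) := by
    rw [← sum_add_distrib, mul_sum]
    refine sum_congr rfl fun k hk => ?_
    have := newtonSeries_succ r k (hden (k + 1) (by simpa using hk))
    linear_combination qStirling r q n (k + 1) * this
  have h4 := newtonSeries_zero r (q := q) h0
  rw [h3]
  simp only [mul_zero, pow_zero]
  linear_combination h4

end Series

end ColoredEulerian

/-! ### Colored letters and the sum over colorings -/

namespace ColoredEulerian

open Finset

/-- An order embedding of the colored letters. -/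
def letterKey (x : ℕ × ℕ) : WithTop (ℤ ×ₗ ℤ) :=
  ((if x.2 = 0 then toLex (x.1, 0) else toLex (-x.1, -x.2) : ℤ ×ₗ ℤ) : WithTop (ℤ ×ₗ ℤ))

lemma letterKey_lt_iff (x y : ℕ × ℕ) : letterKey x < letterKey y ↔ LetterLT x y := by
  unfold letterKey LetterLT
  rw [WithTop.coe_lt_coe]
  split_ifs <;> simp only [Prod.Lex.lt_iff, ofLex_toLex] <;> omega

lemma letterKey_lt_top (x : ℕ × ℕ) : letterKey x < ⊤ := WithTop.coe_lt_top _

lemma letterKey_injective : Function.Injective letterKey := by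
  intro x y h
  have h1 := (letterKey_lt_iff x y).not.1 h.not_lt
  have h2 := (letterKey_lt_iff y x).not.1 h.not_gt
  unfold LetterLT at h1 h2
  exact Prod.ext (by omega) (by omega)

section Recursion

variable {R : Type*} [CommRing R]

/-- The key of the letter `a + 1` under the coloring `c`. -/
def coloredKey {r n : ℕ} (c : Fin n → Fin r) (a : Fin n) : WithTop (ℤ ×ₗ ℤ) :=
  letterKey (a + 1, c a)

lemma coloredKey_injective {r n : ℕ} (c : Fin n → Fin r) :
    Function.Injective (coloredKey c) := by
  intro a b h
  have := congr_arg Prod.fst (letterKey_injective h)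
  exact Fin.ext (by simpa using this)

lemma coloredKey_ne {r n : ℕ} (c : Fin n → Fin r) (a : Fin n) :
    coloredKey c a ≠ letterKey (0, 0) := by
  intro h
  have := congr_arg Prod.fst (letterKey_injective h)
  simp at this

lemma lt_coloredKey_iff {r n : ℕ} (c : Fin n → Fin r) (a : Fin n) :
    letterKey (0, 0) < coloredKey c a ↔ (c a : ℕ) = 0 := by
  rw [coloredKey, letterKey_lt_iff]
  simp [LetterLT]

/-- The descent sums of the letters in `E`, summed over all colorings `c` of all `n` letters with
weight `q ^ ∑ c i`. -/
def coloredSum {n : ℕ} (r : ℕ) (q : R) (x : ℕ → R) (E : Finset (Fin n)) : R :=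
  ∑ c : Fin n → Fin r, (∏ i, q ^ (c i : ℕ)) *
    descentSum (coloredKey c) (letterKey (0, 0)) x #E E

lemma sum_colorings {n : ℕ} (r : ℕ) (hr : 1 ≤ r) (q : R) (E : Finset (Fin n)) :
    (∑ c : Fin n → Fin r, if ∀ a ∈ E, (c a : ℕ) = 0 then ∏ i, q ^ (c i : ℕ) else 0) =
      qInt q r ^ (n - #E) := by
  have h : ∀ c : Fin n → Fin r,
      (if ∀ a ∈ E, (c a : ℕ) = 0 then ∏ i, q ^ (c i : ℕ) else 0) =
      ∏ i, if i ∈ E then (if (c i : ℕ) = 0 then 1 else 0) else q ^ (c i : ℕ) := by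
    intro c
    split_ifs with hc
    · refine prod_congr rfl fun i _ => ?_
      by_cases hi : i ∈ E
      · simp [hi, hc i hi]
      · simp [hi]
    · push Not at hc
      obtain ⟨a, ha, hca⟩ := hc
      exact (prod_eq_zero (mem_univ a) (by simp [ha, hca])).symm
  rw [sum_congr rfl fun c _ => h c, ← Fintype.prod_sum (fun (i : Fin n) (j : Fin r) =>
    if i ∈ E then (if (j : ℕ) = 0 then (1 : R) else 0) else q ^ (j : ℕ))]
  have h2 : ∀ i : Fin n, (∑ j : Fin r, if i ∈ E then (if (j : ℕ) = 0 then (1 : R) else 0)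
      else q ^ (j : ℕ)) = if i ∈ E then 1 else qInt q r := by
    intro i
    split_ifs
    · rw [Fin.sum_univ_eq_sum_range (fun j => if j = 0 then (1 : R) else 0), sum_ite_eq']
      exact if_pos (mem_range.2 hr)
    · exact Fin.sum_univ_eq_sum_range (fun j => q ^ j) r
  rw [prod_congr rfl fun i _ => h2 i, prod_ite]
  simp only [prod_const, one_pow, one_mul]
  congr 1
  have : ({i | i ∉ E} : Finset (Fin n)) = Eᶜ := by ext; simp
  rw [this, card_compl, Fintype.card_fin]

/-- A word increasing from the letter 0 has only color 0 on `E`; the other `n - #E` letters are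
colored freely, each giving `qInt q r`. -/
lemma coloredSum_eq {n : ℕ} (r : ℕ) (hr : 1 ≤ r) (q : R) (x : ℕ → R) (E : Finset (Fin n)) :
    coloredSum r q x E = qInt q r ^ (n - #E) * ∏ i ∈ range #E, (1 - x i) +
      ∑ F ∈ E.ssubsets, x #F * coloredSum r q x F * ∏ i ∈ Ioo #F #E, (1 - x i) := by
  have h : ∀ c : Fin n → Fin r, _ := fun c =>
    descentSum_eq (coloredKey_injective c) (coloredKey_ne c)
    (fun a => letterKey_lt_top (a + 1, c a)) (letterKey_lt_top _) x E
  unfold coloredSum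
  simp only [h, mul_add, sum_add_distrib, lt_coloredKey_iff]
  congr 1
  · rw [← sum_colorings r hr q E, sum_mul]
    refine sum_congr rfl fun c _ => ?_
    split_ifs <;> simp
  · simp only [mul_sum, sum_mul]
    rw [sum_comm]
    exact sum_congr rfl fun F _ => sum_congr rfl fun c _ => by ring

lemma letterKey_letter {r n : ℕ} (π : Equiv.Perm (Fin n)) (c : Fin n → Fin r) (i : ℕ) :
    letterKey (letter ((π, c ∘ π) : ColoredPerm r n) i) =
      letterValue (coloredKey c) (letterKey (0, 0)) π i := by
  unfold letter letterValue
  split_ifs <;> rfl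

lemma term_eq_descentWeight {r n : ℕ} (t q : R) (π : Equiv.Perm (Fin n)) (c : Fin n → Fin r) :
    t ^ des ((π, c ∘ π) : ColoredPerm r n) * q ^ fmaj ((π, c ∘ π) : ColoredPerm r n) =
      (∏ i, q ^ (c i : ℕ)) * descentWeight (coloredKey c) (letterKey (0, 0))
        (fun i => t * q ^ (r * i)) π := by
  unfold des fmaj descentWeight
  simp only [← letterKey_letter, letterKey_lt_iff]
  rw [← prod_filter, prod_mul_distrib, prod_const, prod_pow_eq_pow_sum, prod_pow_eq_pow_sum,
    pow_add, mul_sum, ← Equiv.sum_comp π (fun i => (c i : ℕ))]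
  simp only [descents, Function.comp_apply]
  ring

lemma qEulerian_eq_coloredSum (r n : ℕ) (t q : R) :
    qEulerian r n t q = coloredSum r q (fun i => t * q ^ (r * i)) (univ : Finset (Fin n)) := by
  unfold qEulerian coloredSum descentSum
  -- Colors are reindexed from positions to letters, so that the coloring fixes the order before the
  -- permutation is chosen.
  rw [card_fin, Fintype.sum_prod_type, sum_congr rfl fun (π : Equiv.Perm (Fin n)) _ =>
    (Equiv.sum_comp (Equiv.arrowCongr π.symm (Equiv.refl (Fin r))) _).symm, sum_comm]
  refine sum_congr rfl fun c _ => ?_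
  rw [mul_sum]
  refine sum_bij (fun π _ => π) (fun π _ => ?_) (fun π _ σ _ h => DFunLike.coe_injective h)
    (fun g hg => ?_) (fun π _ => term_eq_descentWeight t q π c)
  · simp [arrangements, π.injective]
  · have hg' : Function.Injective g := by simpa [arrangements] using hg
    exact ⟨Equiv.ofBijective g (Finite.injective_iff_bijective.1 hg'), mem_univ _, rfl⟩

end Recursion

lemma coloredSum_eq_stirlingSeries {K : Type*} [Field K] {n : ℕ} (r : ℕ) (hr : 1 ≤ r) (t q : K)
    (hden : ∀ i ∈ range (n + 1), 1 - t * q ^ (r * i) ≠ 0) (E : Finset (Fin n)) :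
    coloredSum r q (fun i => t * q ^ (r * i)) E = qInt q r ^ (n - #E) *
      (∏ i ∈ range (#E + 1), (1 - t * q ^ (r * i))) * stirlingSeries r #E t q := by
  induction E using Finset.strongInduction with
  | H E ih =>
    have hE : #E ≤ n := by simpa using card_le_univ E
    set P : ℕ → K := fun m => ∏ i ∈ range m, (1 - t * q ^ (r * i)) with hP
    have hsum : ∑ F ∈ E.ssubsets, t * q ^ (r * #F) *
        coloredSum r q (fun i => t * q ^ (r * i)) F * ∏ i ∈ Ioo #F #E, (1 - t * q ^ (r * i)) =
        ∑ F ∈ E.ssubsets, qInt q r ^ (n - #E) * P #E * t *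
          (qInt q r ^ (#E - #F) * q ^ (r * #F) * stirlingSeries r #F t q) := by
      refine sum_congr rfl fun F hF => ?_
      rw [ih F (mem_ssubsets.1 hF)]
      have hlt : #F < #E := card_lt_card (mem_ssubsets.1 hF)
      have h1 : P #E = (∏ i ∈ range (#F + 1), (1 - t * q ^ (r * i))) *
          ∏ i ∈ Ioo #F #E, (1 - t * q ^ (r * i)) :=
        (prod_range_mul_prod_Ico (fun i => 1 - t * q ^ (r * i)) hlt).symm
      rw [h1, show n - #F = n - #E + (#E - #F) by omega, pow_add]
      ring
    have hcard : ∑ F ∈ E.powerset,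
        qInt q r ^ (#E - #F) * q ^ (r * #F) * stirlingSeries r #F t q =
        ∑ j ∈ range (#E + 1),
        ((#E).choose j : K) * qInt q r ^ (#E - j) * q ^ (r * j) * stirlingSeries r j t q := by
      rw [sum_powerset_apply_card
        (fun j => qInt q r ^ (#E - j) * q ^ (r * j) * stirlingSeries r j t q)]
      exact sum_congr rfl fun j _ => by rw [nsmul_eq_mul]; ring
    -- The `F = E` term, moved to the left of the recursion, supplies the extra factor `1 - t * q ^
    -- (r * #E)`.
    rw [← insert_erase (mem_powerset_self E), sum_insert (notMem_erase _ _)] at hcard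
    have hrec := stirlingSeries_rec r #E t q fun i hi =>
      hden i (by rw [mem_range] at hi ⊢; omega)
    rw [← hcard] at hrec
    rw [coloredSum_eq r hr, hsum, ← mul_sum, prod_range_succ]
    simp only [Nat.sub_self, pow_zero, one_mul] at hrec
    change _ + _ * (∑ F ∈ E.powerset.erase E, _) = _
    linear_combination (-(qInt q r ^ (n - #E) * P #E)) * hrec

lemma exponent_eq (r k : ℕ) : (r : ℤ) * ((k + 1).choose 2 : ℤ) + (1 - (r : ℤ)) * (k : ℤ) =
    ((r * k.choose 2 + k : ℕ) : ℤ) := by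
  rw [Nat.choose_succ_succ' k 1, Nat.choose_one_right]
  push_cast
  ring

end ColoredEulerian

/-- The identity holds for all values of `t` and `q` in a field at which the denominators do not
vanish; the identity of rational functions is the case where `t` and `q` are the two
indeterminates in the field of fractions of a polynomial ring. -/
theorem proposition4p1 {K : Type*} [Field K] (r n : ℕ) (hr : 1 ≤ r) (t q : K)
    (hden : ∀ i ∈ Finset.range (n + 1), 1 - t * q ^ (r * i) ≠ 0) :
    ColoredEulerian.qEulerian r n t q / ∏ i ∈ Finset.range (n + 1), (1 - t * q ^ (r * i)) =
      ∑ k ∈ Finset.range (n + 1),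
        (q ^ ((r : ℤ) * ((k + 1).choose 2 : ℤ) + (1 - (r : ℤ)) * (k : ℤ)) *
            ColoredEulerian.qInt q r ^ k * ColoredEulerian.qFactorial (q ^ r) k *
            ColoredEulerian.qStirling r q n k * t ^ k) /
          ∏ i ∈ Finset.range (k + 1), (1 - t * q ^ (r * i)) := by
  rw [ColoredEulerian.qEulerian_eq_coloredSum,
    ColoredEulerian.coloredSum_eq_stirlingSeries r hr t q hden, Finset.card_fin, Nat.sub_self,
    pow_zero, one_mul, mul_div_cancel_left₀ _ (Finset.prod_ne_zero_iff.2 hden),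
    ColoredEulerian.stirlingSeries]
  refine Finset.sum_congr rfl fun k _ => ?_
  rw [ColoredEulerian.exponent_eq, zpow_natCast, ColoredEulerian.newtonSeries, ← mul_div_assoc]
  congr 1
  ring
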